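/- All manifolds, maps, forms and vector fields are smooth; manifolds are finite-dimensional, Hausdorff and without boundary. A co-oriented codimension $1$ distribution on a manifold $N$ is a family $\xi=\ker\alpha\subset TN$ for some nowhere vanishing $1$-form $\alpha$ on $N$; it is a contact structure if, for such an $\alpha$, the form $d\alpha|_{\xi_m}$ is nondegenerate for every $m\in N$. A contact fiber bundle $(F\to M\xrightarrow{\pi}B,\xi)$ is a fiber bundle together with a co-oriented codimension $1$ distribution $\xi$ on $M$ such that $\xi\cap T(F_b)$ is a contact structure on the fiber $F_b=\pi^{-1}(b)$ for every $b\in B$. Its contact connection is $$\mathcal H(\xi)_m=\{x\in\xi_m \mid d\alpha_m(x,y)=0\ \text{ for all } y\in\xi_m\cap\ker d\pi_m\},\qquad \ker\alpha=\xi,$$ which does not depend on the choice of $\alpha$ and is a complement of $\ker d\pi_m$ in $T_mM$. For a vector field $v$ on $B$ let $v^\#$ be its horizontal lift: $v^\#(m)\in\mathcal H(\xi)_m$ and $d\pi(v^\#(m))=v(\pi(m))$. The curvature of $\mathcal H=\mathcal H(\xi)$ at $x,y\in T_bB$ is the vector field along $F_b$ $$(\mathrm{Curv}_{\mathcal H})_b(x,y)=[v^\#,w^\#]-[v,w]^\#,$$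 where $v,w$ are vector fields on $B$ with $v(b)=x$, $w(b)=y$ (it does not depend on the choice of $v,w$). **Proposition.** Let $(F\to M\xrightarrow{\pi}B,\xi)$ be a contact fiber bundle, $\mathcal H=\mathcal H(\xi)$ its contact connection, and $\xi^\circ\subset T^*M$ the annihilator of $\xi$. Then $\xi$ is a contact structure on $M$ if and only if for all $m\in M$ and all $0\neq\eta\in\xi^\circ_m$ the $2$-form $$\big\langle \eta,\,[(\mathrm{Curv}_{\mathcal H})_b(\cdot,\cdot)](m)\big\rangle : T_bB\times T_bB\to\mathbb R,\qquad b=\pi(m),$$ is nondegenerate. -/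

import Mathlib

open scoped Manifold ContDiff

noncomputable section

namespace ContactGeometry

/- Manifolds are smooth, without boundary, and modelled on a finite-dimensional real vector
space `E`; they carry the model `𝓘(ℝ, E)`. -/

section Forms

variable {E : Type*} [NormedAddCommGroup E] [NormedSpace ℝ E]
  {M : Type*} [TopologicalSpace M] [ChartedSpace E M]

/-- A field of covectors on `M` is a smooth one-form if it is a smooth section of the
cotangent bundle of `M`. -/
def IsSmoothOneForm [IsManifold 𝓘(ℝ, E) ∞ M]
    (α : ∀ m : M, TangentSpace 𝓘(ℝ, E) m →L[ℝ] ℝ) : Prop :=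
  ContMDiff 𝓘(ℝ, E) (𝓘(ℝ, E).prod 𝓘(ℝ, E →L[ℝ] ℝ)) ∞
    (fun m => Bundle.TotalSpace.mk' (E →L[ℝ] ℝ)
      (E := fun m : M => TangentSpace 𝓘(ℝ, E) m →L[ℝ] Bundle.Trivial M ℝ m) m (α m))

/-- A smooth vector field: a smooth section of the tangent bundle. -/
def IsSmoothVectorField [IsManifold 𝓘(ℝ, E) ∞ M]
    (v : ∀ m : M, TangentSpace 𝓘(ℝ, E) m) : Prop :=
  ContMDiff 𝓘(ℝ, E) 𝓘(ℝ, E).tangent ∞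
    (fun m => (⟨m, v m⟩ : TangentBundle 𝓘(ℝ, E) M))

/-- The one-form `α` expressed in the chart `φ` of `M` at `m`, that is, `(φ⁻¹)^* α`. -/
def oneFormInChart (α : ∀ m : M, TangentSpace 𝓘(ℝ, E) m →L[ℝ] ℝ) (m : M) :
    E → (E →L[ℝ] ℝ) := fun z =>
  (α ((extChartAt 𝓘(ℝ, E) m).symm z)).comp
    (mfderiv 𝓘(ℝ, E) 𝓘(ℝ, E) (extChartAt 𝓘(ℝ, E) m).symm z)

/-- The exterior derivative of a one-form at `m`, as a bilinear form on `T_m M`.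
It is computed in the chart `φ` at `m`: with `a = (φ⁻¹)^* α`, one has
`dα (x, y) = (D a (dφ x)) (dφ y) - (D a (dφ y)) (dφ x)`, so that
`dα (X, Y) = X (α Y) - Y (α X) - α [X, Y]` for vector fields. -/
def extDerivOneForm (α : ∀ m : M, TangentSpace 𝓘(ℝ, E) m →L[ℝ] ℝ) (m : M) :
    TangentSpace 𝓘(ℝ, E) m →L[ℝ] TangentSpace 𝓘(ℝ, E) m →L[ℝ] ℝ :=
  let φ := extChartAt 𝓘(ℝ, E) m
  let D : E →L[ℝ] E →L[ℝ] ℝ := fderiv ℝ (oneFormInChart α m) (φ m)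
  let P : E →L[ℝ] E := mfderiv 𝓘(ℝ, E) 𝓘(ℝ, E) φ m
  let W : E →L[ℝ] E →L[ℝ] ℝ := (D - D.flip).bilinearComp P P
  W

lemma extDerivOneForm_apply (α : ∀ m : M, TangentSpace 𝓘(ℝ, E) m →L[ℝ] ℝ) (m : M)
    (x y : TangentSpace 𝓘(ℝ, E) m) :
    let φ := extChartAt 𝓘(ℝ, E) m
    let x' : E := mfderiv 𝓘(ℝ, E) 𝓘(ℝ, E) φ m x
    let y' : E := mfderiv 𝓘(ℝ, E) 𝓘(ℝ, E) φ m y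
    extDerivOneForm α m x y =
      fderiv ℝ (oneFormInChart α m) (φ m) x' y' - fderiv ℝ (oneFormInChart α m) (φ m) y' x' :=
  rfl

/-- `α` is a smooth nowhere vanishing one-form with `ker α = ξ`. -/
structure IsDefiningForm [IsManifold 𝓘(ℝ, E) ∞ M]
    (ξ : ∀ m : M, Submodule ℝ (TangentSpace 𝓘(ℝ, E) m))
    (α : ∀ m : M, TangentSpace 𝓘(ℝ, E) m →L[ℝ] ℝ) : Prop where
  smooth : IsSmoothOneForm α
  ne_zero : ∀ m, α m ≠ 0
  mem_iff : ∀ m (x : TangentSpace 𝓘(ℝ, E) m), x ∈ ξ m ↔ α m x = 0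

/-- `ξ` is a (smooth) co-oriented distribution of codimension one: the kernel of a nowhere
vanishing one-form. -/
def IsCoorientedHyperplaneField [IsManifold 𝓘(ℝ, E) ∞ M]
    (ξ : ∀ m : M, Submodule ℝ (TangentSpace 𝓘(ℝ, E) m)) : Prop :=
  ∃ α, IsDefiningForm ξ α

/-- `ξ` is a (co-oriented) contact structure: `ξ = ker α` for a nowhere vanishing one-form `α`
such that the (skew-symmetric) restriction of `dα` to `ξ` is nondegenerate at every point. -/
def IsContactStructure [IsManifold 𝓘(ℝ, E) ∞ M]
    (ξ : ∀ m : M, Submodule ℝ (TangentSpace 𝓘(ℝ, E) m)) : Prop :=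
  ∃ α, IsDefiningForm ξ α ∧
    ∀ m, ∀ x ∈ ξ m, (∀ y ∈ ξ m, extDerivOneForm α m x y = 0) → x = 0

end Forms

section Bundles

variable {EB : Type*} [NormedAddCommGroup EB] [NormedSpace ℝ EB]
  {B : Type*} [TopologicalSpace B] [ChartedSpace EB B]
  {EF : Type*} [NormedAddCommGroup EF] [NormedSpace ℝ EF]
  {F : Type*} [TopologicalSpace F] [ChartedSpace EF F]
  {EM : Type*} [NormedAddCommGroup EM] [NormedSpace ℝ EM]
  {M : Type*} [TopologicalSpace M] [ChartedSpace EM M]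

/-- A local trivialization `π⁻¹(U) ≅ U × F` of `π` is smooth if it is a diffeomorphism. -/
def IsSmoothTrivialization {π : M → B} (e : Bundle.Trivialization F π) : Prop :=
  ContMDiffOn 𝓘(ℝ, EM) (𝓘(ℝ, EB).prod 𝓘(ℝ, EF)) ∞ e e.source ∧
  ContMDiffOn (𝓘(ℝ, EB).prod 𝓘(ℝ, EF)) 𝓘(ℝ, EM) ∞ e.toOpenPartialHomeomorph.symm e.target

/-- The parametrization `F ≅ F_b ⊆ M` of the fiber over `b` given by a local trivialization. -/
def fiberParam {π : M → B} (e : Bundle.Trivialization F π) (b : B) : F → M :=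
  fun f => e.toOpenPartialHomeomorph.symm (b, f)

/-- The distribution `ξ ∩ T(F_b)` on the fiber over `b`, transported to `F` by the
parametrization of `F_b` given by a local trivialization. -/
def fiberDistribution (ξ : ∀ m : M, Submodule ℝ (TangentSpace 𝓘(ℝ, EM) m)) {π : M → B}
    (e : Bundle.Trivialization F π) (b : B) (f : F) : Submodule ℝ (TangentSpace 𝓘(ℝ, EF) f) :=
  (ξ (fiberParam e b f)).comap
    (mfderiv 𝓘(ℝ, EF) 𝓘(ℝ, EM) (fiberParam e b) f).toLinearMap

variable (F) in
/-- `F → M → B` (with projection `π`) together with `ξ` is a contact fiber bundle: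
it is a smooth fiber bundle with typical fiber `F`, `ξ` is a co-oriented distribution of
codimension one on `M`, and `ξ ∩ T(F_b)` is a contact structure on every fiber `F_b`.
The last condition is expressed on `F` through a smooth local trivialization near `b`;
since the transition maps are diffeomorphisms of `F`, it does not matter which one is used. -/
structure IsContactFiberBundle [IsManifold 𝓘(ℝ, EF) ∞ F] [IsManifold 𝓘(ℝ, EM) ∞ M]
    (π : M → B) (ξ : ∀ m : M, Submodule ℝ (TangentSpace 𝓘(ℝ, EM) m)) : Prop where
  smooth_proj : ContMDiff 𝓘(ℝ, EM) 𝓘(ℝ, EB) ∞ π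
  cooriented : IsCoorientedHyperplaneField ξ
  contact_fiber : ∀ b : B, ∃ e : Bundle.Trivialization F π, b ∈ e.baseSet ∧
    IsSmoothTrivialization (EB := EB) (EF := EF) (EM := EM) e ∧
    IsContactStructure (E := EF) (fiberDistribution ξ e b)

variable (EB) in
/-- The vertical space `V_m = ker dπ_m`. -/
def verticalSpace (π : M → B) (m : M) : Submodule ℝ (TangentSpace 𝓘(ℝ, EM) m) :=
  LinearMap.ker (mfderiv 𝓘(ℝ, EM) 𝓘(ℝ, EB) π m).toLinearMap

variable (EB) in
/-- The contact connection `H(ξ)`: the `dα`-orthogonal complement of `ξ ∩ V` in `ξ`, where `α` is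
a one-form with kernel `ξ`. The complement is the same for all such `α`, so it is written
here with all of them simultaneously. -/
def contactConnection [IsManifold 𝓘(ℝ, EM) ∞ M] (π : M → B)
    (ξ : ∀ m : M, Submodule ℝ (TangentSpace 𝓘(ℝ, EM) m)) (m : M) :
    Submodule ℝ (TangentSpace 𝓘(ℝ, EM) m) where
  carrier := {x | x ∈ ξ m ∧ ∀ α, IsDefiningForm ξ α →
    ∀ y ∈ ξ m ⊓ verticalSpace EB π m, extDerivOneForm α m x y = 0}
  add_mem' := by
    rintro x x' ⟨hx, hx2⟩ ⟨hx', hx2'⟩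
    refine ⟨add_mem hx hx', fun α hα y hy => ?_⟩
    rw [map_add, add_apply, hx2 α hα y hy, hx2' α hα y hy, add_zero]
  zero_mem' := ⟨zero_mem _, fun α _ y _ => by rw [map_zero, zero_apply]⟩
  smul_mem' := by
    rintro c x ⟨hx, hx2⟩
    refine ⟨Submodule.smul_mem _ c hx, fun α hα y hy => ?_⟩
    rw [map_smul, smul_apply, hx2 α hα y hy, smul_zero]

open Classical in
/-- The horizontal lift `v^#` of a vector field `v` on `B` with respect to a connection `H`:
`v^#(m)` is the unique vector in `H m` with `dπ (v^#(m)) = v (π m)`. -/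
def horizontalLift (π : M → B) (H : ∀ m : M, Submodule ℝ (TangentSpace 𝓘(ℝ, EM) m))
    (v : ∀ b : B, TangentSpace 𝓘(ℝ, EB) b) (m : M) : TangentSpace 𝓘(ℝ, EM) m :=
  if h : ∃ u ∈ H m, mfderiv 𝓘(ℝ, EM) 𝓘(ℝ, EB) π m u = v (π m) then h.choose else 0

/-- `[v^#, w^#] - [v, w]^#` for vector fields `v`, `w` on `B`. -/
def curvatureOfFields (π : M → B) (H : ∀ m : M, Submodule ℝ (TangentSpace 𝓘(ℝ, EM) m))
    (v w : ∀ b : B, TangentSpace 𝓘(ℝ, EB) b) (m : M) : TangentSpace 𝓘(ℝ, EM) m :=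
  VectorField.mlieBracket 𝓘(ℝ, EM) (horizontalLift π H v) (horizontalLift π H w) m -
    horizontalLift π H (VectorField.mlieBracket 𝓘(ℝ, EB) v w) m

open Classical in
/-- A smooth vector field on `B` with the prescribed value `x` at `b`. -/
def extendVector [IsManifold 𝓘(ℝ, EB) ∞ B] {b : B} (x : TangentSpace 𝓘(ℝ, EB) b) :
    ∀ b' : B, TangentSpace 𝓘(ℝ, EB) b' :=
  if h : ∃ v : ∀ b' : B, TangentSpace 𝓘(ℝ, EB) b', IsSmoothVectorField v ∧ v b = x
  then h.choose else 0

/-- The curvature `Curv_H` of the connection `H`: for `x, y ∈ T_b B`, `b = π m`, the value at `m`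
of the vector field `Curv_H(x, y) = [v^#, w^#] - [v, w]^#` along the fiber `F_b`, where `v`, `w`
are smooth vector fields on `B` with `v(b) = x`, `w(b) = y`. The expression is tensorial in
`v` and `w`, so the choice of extensions is immaterial. -/
def curvature [IsManifold 𝓘(ℝ, EB) ∞ B] (π : M → B)
    (H : ∀ m : M, Submodule ℝ (TangentSpace 𝓘(ℝ, EM) m)) (m : M)
    (x y : TangentSpace 𝓘(ℝ, EB) (π m)) : TangentSpace 𝓘(ℝ, EM) m :=
  curvatureOfFields π H (extendVector x) (extendVector y) m

end Bundles

end ContactGeometry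

end

/-! Fix a one-form `α` with kernel `ξ`. The restriction of `dα` to `ξ ∩ ker dπ` is nondegenerate:
pulled back to a fiber, `α` has the same kernel as the given contact form, and defining forms of the
same distribution have proportional exterior derivatives on it
(`exists_extDerivOneForm_eq_smul`, `IsContactFiberBundle.isFiberwiseContact`). Hence `ξ` is the
`dα`-orthogonal sum of `ξ ∩ ker dπ` and of the contact connection `H`, the projection maps `H`
isomorphically onto the tangent space of `B`, and `dα` is nondegenerate on `ξ` if and only if it is
nondegenerate on `H` (`IsFiberwiseContact.nondegenerate_iff`).

On horizontal lifts `dα` is, up to sign, the curvature paired with `α`. Indeed `α` annihilates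
`v^#`, `w^#` and `[v, w]^#`, so Cartan's formula gives
`dα (v^#, w^#) = - α [v^#, w^#] = - α (Curv (v, w))` (`IsContactFiberBundle.apply_curvature`).
As the annihilator of `ξ` at a point is spanned by `α`, the equivalence follows.

Cartan's formula needs `v^#` to be differentiable. The orthogonality conditions that define the
lift are written, with Lagrange multipliers, as a square linear system whose coefficients are the
chart expressions of `α`, `dα` and `dπ` (`liftSystem`). It is invertible by the nondegeneracy above,
and inversion of linear maps is smooth
(`IsContactFiberBundle.differentiableAt_fieldInChart_horizontalLift`). -/

namespace ContactGeometry

open Filter Topology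

/-! ### One-forms on a vector space -/

section ModelForms

variable {E : Type*} [NormedAddCommGroup E] [NormedSpace ℝ E]
  {E' : Type*} [NormedAddCommGroup E'] [NormedSpace ℝ E']

/-- The exterior derivative of a one-form on an open subset of a vector space, as a bilinear
form, with the normalization of `extDerivOneForm`. -/
noncomputable def modelExtDeriv (a : E → (E →L[ℝ] ℝ)) (z : E) : E →L[ℝ] E →L[ℝ] ℝ :=
  fderiv ℝ a z - (fderiv ℝ a z).flip

lemma modelExtDeriv_apply (a : E → (E →L[ℝ] ℝ)) (z x y : E) :
    modelExtDeriv a z x y = fderiv ℝ a z x y - fderiv ℝ a z y x := rfl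

lemma modelExtDeriv_congr {a b : E → (E →L[ℝ] ℝ)} {z : E} (h : a =ᶠ[𝓝 z] b) :
    modelExtDeriv a z = modelExtDeriv b z := by
  simp only [modelExtDeriv, h.fderiv_eq]

lemma differentiableAt_clm_comp {V W : Type*} [NormedAddCommGroup V] [NormedSpace ℝ V]
    [NormedAddCommGroup W] [NormedSpace ℝ W] (L : V →L[ℝ] W) {f : E → V} {z : E}
    (hf : DifferentiableAt ℝ f z) : DifferentiableAt ℝ (fun w => L (f w)) z := by
  fun_prop

lemma differentiableAt_modelExtDeriv {a : E → (E →L[ℝ] ℝ)} {z : E} (ha : ContDiffAt ℝ 2 a z) :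
    DifferentiableAt ℝ (modelExtDeriv a) z := by
  have h : DifferentiableAt ℝ (fderiv ℝ a) z :=
    (ha.fderiv_right (m := 1) (by norm_num)).differentiableAt (by norm_num)
  obtain ⟨L, hL⟩ : ∃ L : (E →L[ℝ] E →L[ℝ] ℝ) →L[ℝ] (E →L[ℝ] E →L[ℝ] ℝ), ∀ f, L f = f.flip :=
    ⟨ContinuousLinearMap.flipₗᵢ ℝ E E ℝ, fun _ => rfl⟩
  have h' : DifferentiableAt ℝ (fun w => L (fderiv ℝ a w)) z :=
    differentiableAt_clm_comp (V := E →L[ℝ] E →L[ℝ] ℝ) (W := E →L[ℝ] E →L[ℝ] ℝ) L h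
  simp only [hL] at h'
  exact DifferentiableAt.fun_sub (𝕜 := ℝ) (E := E) (F := E →L[ℝ] E →L[ℝ] ℝ) h h'

lemma hasFDerivAt_pullback {f : E → E'} {a : E' → (E' →L[ℝ] ℝ)} {z : E}
    (hf : ContDiffAt ℝ 2 f z) (ha : DifferentiableAt ℝ a (f z)) :
    HasFDerivAt (fun w => (a (f w)).comp (fderiv ℝ f w))
      ((ContinuousLinearMap.compL ℝ E E' ℝ (a (f z))).comp (fderiv ℝ (fderiv ℝ f) z) +
        ((ContinuousLinearMap.compL ℝ E E' ℝ).flip (fderiv ℝ f z)).comp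
          ((fderiv ℝ a (f z)).comp (fderiv ℝ f z))) z := by
  have hf1 : HasFDerivAt f (fderiv ℝ f z) z :=
    (hf.differentiableAt (by norm_num)).hasFDerivAt
  have hf2 : HasFDerivAt (fderiv ℝ f) (fderiv ℝ (fderiv ℝ f) z) z :=
    ((hf.fderiv_right (m := 1) (by norm_num)).differentiableAt (by norm_num)).hasFDerivAt
  exact (ha.hasFDerivAt.comp z hf1).clm_comp hf2

/-- The exterior derivative commutes with pullback; this is the symmetry of second derivatives. -/
lemma modelExtDeriv_pullback {f : E → E'} {a : E' → (E' →L[ℝ] ℝ)} {z : E}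
    (hf : ContDiffAt ℝ 2 f z) (ha : DifferentiableAt ℝ a (f z)) (x y : E) :
    modelExtDeriv (fun w => (a (f w)).comp (fderiv ℝ f w)) z x y =
      modelExtDeriv a (f z) (fderiv ℝ f z x) (fderiv ℝ f z y) := by
  have hs : IsSymmSndFDerivAt ℝ f z := hf.isSymmSndFDerivAt (by simp)
  simp only [modelExtDeriv_apply, (hasFDerivAt_pullback hf ha).fderiv]
  simp [hs.eq x y]

/-- Two one-forms with the same kernel have proportional exterior derivatives on that kernel. -/
lemma modelExtDeriv_of_ker_eq {a b : E → (E →L[ℝ] ℝ)} {z : E}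
    (ha : DifferentiableAt ℝ a z) (hb : DifferentiableAt ℝ b z)
    (hker : ∀ᶠ w in 𝓝 z, ∀ x, a w x = 0 ↔ b w x = 0) (ha0 : a z ≠ 0) :
    ∃ c : ℝ, c ≠ 0 ∧ ∀ x y, a z x = 0 → a z y = 0 →
      modelExtDeriv b z x y = c * modelExtDeriv a z x y := by
  obtain ⟨u, hu⟩ : ∃ u, a z u ≠ 0 := by
    by_contra! h
    exact ha0 (ContinuousLinearMap.ext h)
  have hbu : b z u ≠ 0 := fun h => hu ((hker.self_of_nhds u).2 h)
  -- The proportionality `a(u) b = b(u) a` near `z`, to be differentiated on vectors of the kernel.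
  have key : ∀ y, (fun w => a w u * b w y) =ᶠ[𝓝 z] fun w => b w u * a w y := by
    intro y
    filter_upwards [hker] with w hw
    have h1 : b w (a w u • y - a w y • u) = 0 := by
      rw [← hw]
      simp [mul_comm]
    simp only [map_sub, map_smul, smul_eq_mul] at h1
    linarith
  have hda : ∀ y, HasFDerivAt (fun w => a w y) ((fderiv ℝ a z).flip y) z := fun y => by
    simpa using! ha.hasFDerivAt.clm_apply (hasFDerivAt_const y z)
  have hdb : ∀ y, HasFDerivAt (fun w => b w y) ((fderiv ℝ b z).flip y) z := fun y => by
    simpa using! hb.hasFDerivAt.clm_apply (hasFDerivAt_const y z)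
  have hD : ∀ x y, a z y = 0 → a z u * fderiv ℝ b z x y = b z u * fderiv ℝ a z x y := by
    intro x y hy
    have hy' : b z y = 0 := (hker.self_of_nhds y).1 hy
    have h := (key y).fderiv_eq (𝕜 := ℝ)
    have h1 : fderiv ℝ (fun w => a w u * b w y) z = _ := ((hda u).mul (hdb y)).fderiv
    have h2 : fderiv ℝ (fun w => b w u * a w y) z = _ := ((hdb u).mul (hda y)).fderiv
    rw [h1, h2] at h
    simpa [hy, hy'] using congr($h x)
  refine ⟨b z u / a z u, div_ne_zero hbu hu, fun x y hx hy => ?_⟩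
  have h1 := hD x y hy
  have h2 := hD y x hx
  rw [modelExtDeriv_apply, modelExtDeriv_apply]
  field_simp
  linarith

/-- Cartan's formula for vector fields that are annihilated by the one-form. -/
lemma modelExtDeriv_eq_neg_lieBracket {a : E → (E →L[ℝ] ℝ)} {X Y : E → E} {z : E}
    (ha : DifferentiableAt ℝ a z) (hX : DifferentiableAt ℝ X z) (hY : DifferentiableAt ℝ Y z)
    (hX0 : ∀ᶠ w in 𝓝 z, a w (X w) = 0) (hY0 : ∀ᶠ w in 𝓝 z, a w (Y w) = 0) :
    modelExtDeriv a z (X z) (Y z) = -a z (VectorField.lieBracket ℝ X Y z) := by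
  have key : ∀ {Z : E → E}, DifferentiableAt ℝ Z z → (∀ᶠ w in 𝓝 z, a w (Z w) = 0) →
      ∀ u, fderiv ℝ a z u (Z z) = - a z (fderiv ℝ Z z u) := by
    intro Z hZ h0 u
    have h1 : fderiv ℝ (fun w => a w (Z w)) z = _ :=
      (ha.hasFDerivAt.clm_apply hZ.hasFDerivAt).fderiv
    have h2 : fderiv ℝ (fun w => a w (Z w)) z = 0 := by
      rw [EventuallyEq.fderiv_eq (f := fun _ => (0 : ℝ)) h0]
      simp
    rw [h2] at h1
    have h3 := congr($h1 u)
    simp at h3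
    linarith
  rw [modelExtDeriv_apply, key hY hY0, key hX hX0, VectorField.lieBracket, map_sub]
  ring

end ModelForms

/-! ### Linear algebra of the horizontal complement -/

section LinearAlgebra

variable {E : Type*} [NormedAddCommGroup E] [NormedSpace ℝ E]
  {G : Type*} [NormedAddCommGroup G] [NormedSpace ℝ G]

/-- The infinitesimal model of a contact fiber bundle at a point: `a` is the defining covector,
`P` the differential of the projection, and `σ` the exterior derivative of the defining form. -/
structure IsFiberwiseContact (a : E →L[ℝ] ℝ) (P : E →L[ℝ] G) (σ : E →L[ℝ] E →L[ℝ] ℝ) : Prop where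
  surjective : Function.Surjective P
  exists_vertical : ∃ y, P y = 0 ∧ a y ≠ 0
  nondegenerate : ∀ x, a x = 0 → P x = 0 →
    (∀ y, a y = 0 → P y = 0 → σ x y = 0) → x = 0

/-- The vector `x` lies in the `σ`-orthogonal complement of `ker a ∩ ker P` in `ker a`. -/
def IsHorizontal (a : E →L[ℝ] ℝ) (P : E →L[ℝ] G) (σ : E →L[ℝ] E →L[ℝ] ℝ) (x : E) : Prop :=
  a x = 0 ∧ ∀ y, a y = 0 → P y = 0 → σ x y = 0

lemma IsFiberwiseContact.eq_of_isHorizontal {a : E →L[ℝ] ℝ} {P : E →L[ℝ] G}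
    {σ : E →L[ℝ] E →L[ℝ] ℝ} (h : IsFiberwiseContact a P σ) {x y : E}
    (hx : IsHorizontal a P σ x) (hy : IsHorizontal a P σ y) (hxy : P x = P y) : x = y := by
  rw [← sub_eq_zero]
  refine h.nondegenerate _ (by simp [hx.1, hy.1]) (by simp [hxy]) fun u hu hu' => ?_
  simp [hx.2 u hu hu', hy.2 u hu hu']

/-- Since `ker a` is the `σ`-orthogonal sum of its vertical part, on which `σ` is nondegenerate,
and of the horizontal vectors, `σ` is nondegenerate on `ker a` if and only if it is so on
horizontal lifts. -/
lemma IsFiberwiseContact.nondegenerate_iff {a : E →L[ℝ] ℝ} {P : E →L[ℝ] G}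
    {σ : E →L[ℝ] E →L[ℝ] ℝ} (h : IsFiberwiseContact a P σ) {l : G → E}
    (hl : ∀ x, IsHorizontal a P σ (l x)) (hPl : ∀ x, P (l x) = x) :
    (∀ x, a x = 0 → (∀ y, a y = 0 → σ x y = 0) → x = 0) ↔
      ∀ x, (∀ y, σ (l x) (l y) = 0) → x = 0 := by
  constructor
  · intro hnd x hx
    rw [← hPl x, hnd (l x) (hl x).1 fun u hu => ?_, map_zero]
    have h1 := (hl x).2 (u - l (P u)) (by simp [hu, (hl _).1]) (by simp [hPl])
    rw [map_sub, hx, sub_zero] at h1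
    exact h1
  · intro hnd x hx hσ
    have hxl : x = l (P x) := h.eq_of_isHorizontal ⟨hx, fun y hy _ => hσ y hy⟩ (hl _) (hPl _).symm
    have hP : P x = 0 := hnd _ fun y => by rw [← hxl]; exact hσ _ (hl y).1
    exact h.nondegenerate x hx hP fun y hy _ => hσ y hy

/-- The linear system with Lagrange multipliers that characterizes horizontal lifts: `x` is
horizontal with `P x = g` as soon as `liftSystem a P σ (x, s, μ) = (0, 0, g)` for some
multipliers `s`, `μ`. -/
noncomputable def liftSystem (a : E →L[ℝ] ℝ) (P : E →L[ℝ] G) (σ : E →L[ℝ] E →L[ℝ] ℝ) :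
    (E × ℝ × (G →L[ℝ] ℝ)) →L[ℝ] ((E →L[ℝ] ℝ) × ℝ × G) :=
  (ContinuousLinearMap.inl ℝ _ _).comp
    (σ.comp (.fst ℝ _ _) +
      (ContinuousLinearMap.toSpanSingleton ℝ a).comp
        ((ContinuousLinearMap.fst ℝ _ _).comp (.snd ℝ _ _)) +
      ((ContinuousLinearMap.compL ℝ E G ℝ).flip P).comp
        ((ContinuousLinearMap.snd ℝ _ _).comp (.snd ℝ _ _))) +
  (ContinuousLinearMap.inr ℝ _ _).comp
    ((ContinuousLinearMap.inl ℝ _ _).comp (a.comp (.fst ℝ _ _)) +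
      (ContinuousLinearMap.inr ℝ _ _).comp (P.comp (.fst ℝ _ _)))

lemma liftSystem_apply (a : E →L[ℝ] ℝ) (P : E →L[ℝ] G) (σ : E →L[ℝ] E →L[ℝ] ℝ)
    (x : E) (s : ℝ) (μ : G →L[ℝ] ℝ) :
    liftSystem a P σ (x, s, μ) = (σ x + s • a + μ.comp P, a x, P x) := by
  simp [liftSystem]

lemma isHorizontal_of_liftSystem {a : E →L[ℝ] ℝ} {P : E →L[ℝ] G} {σ : E →L[ℝ] E →L[ℝ] ℝ}
    {p : E × ℝ × (G →L[ℝ] ℝ)} {g : G} (h : liftSystem a P σ p = (0, 0, g)) :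
    IsHorizontal a P σ p.1 ∧ P p.1 = g := by
  obtain ⟨x, s, μ⟩ := p
  simp only [liftSystem_apply, Prod.mk.injEq] at h
  refine ⟨⟨h.2.1, fun y hy hy' => ?_⟩, h.2.2⟩
  simpa [hy, hy'] using congr($(h.1) y)

lemma differentiableAt_liftSystem {a : E → (E →L[ℝ] ℝ)} {P : E → (E →L[ℝ] G)}
    {σ : E → (E →L[ℝ] E →L[ℝ] ℝ)} {z : E} (ha : DifferentiableAt ℝ a z)
    (hP : DifferentiableAt ℝ P z) (hσ : DifferentiableAt ℝ σ z) :
    DifferentiableAt ℝ (fun w => liftSystem (a w) (P w) (σ w)) z := by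
  -- The two operations on `a` and `P` are continuous linear maps.
  obtain ⟨L, hL⟩ : ∃ L : (E →L[ℝ] ℝ) →L[ℝ] (ℝ →L[ℝ] E →L[ℝ] ℝ),
      ∀ f, L f = .toSpanSingleton ℝ f :=
    ⟨ContinuousLinearMap.smulRightL ℝ ℝ (E →L[ℝ] ℝ) (.id ℝ ℝ), fun _ => by ext; simp⟩
  obtain ⟨L', hL'⟩ : ∃ L : (E →L[ℝ] G) →L[ℝ] ((G →L[ℝ] ℝ) →L[ℝ] E →L[ℝ] ℝ),
      ∀ f, L f = (ContinuousLinearMap.compL ℝ E G ℝ).flip f :=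
    ⟨(ContinuousLinearMap.compL ℝ E G ℝ).flip, fun _ => rfl⟩
  have h1 : DifferentiableAt ℝ (fun w => L (a w)) z :=
    differentiableAt_clm_comp (V := E →L[ℝ] ℝ) (W := ℝ →L[ℝ] E →L[ℝ] ℝ) L ha
  have h2 : DifferentiableAt ℝ (fun w => L' (P w)) z :=
    differentiableAt_clm_comp (V := E →L[ℝ] G) (W := (G →L[ℝ] ℝ) →L[ℝ] E →L[ℝ] ℝ) L' hP
  simp only [liftSystem, ← hL, ← hL']
  refine DifferentiableAt.fun_add (𝕜 := ℝ) (E := E)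
    (F := E × ℝ × (G →L[ℝ] ℝ) →L[ℝ] (E →L[ℝ] ℝ) × ℝ × G) ?_ ?_
  · apply DifferentiableAt.clm_comp (differentiableAt_const _)
    refine DifferentiableAt.fun_add (𝕜 := ℝ) (E := E)
      (F := E × ℝ × (G →L[ℝ] ℝ) →L[ℝ] E →L[ℝ] ℝ) ?_ ?_
    refine DifferentiableAt.fun_add (𝕜 := ℝ) (E := E)
      (F := E × ℝ × (G →L[ℝ] ℝ) →L[ℝ] E →L[ℝ] ℝ) ?_ ?_
    · exact hσ.clm_comp (differentiableAt_const _)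
    · exact h1.clm_comp (differentiableAt_const _)
    · exact h2.clm_comp (differentiableAt_const _)
  · apply DifferentiableAt.clm_comp (differentiableAt_const _)
    refine DifferentiableAt.fun_add (𝕜 := ℝ) (E := E) (F := E × ℝ × (G →L[ℝ] ℝ) →L[ℝ] ℝ × G) ?_ ?_
    · apply DifferentiableAt.clm_comp (differentiableAt_const _)
      exact ha.clm_comp (differentiableAt_const _)
    · apply DifferentiableAt.clm_comp (differentiableAt_const _)
      exact hP.clm_comp (differentiableAt_const _)

variable [FiniteDimensional ℝ E] [FiniteDimensional ℝ G]

/-- The first component of a solution of the homogeneous system vanishes by nondegeneracy on the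
vertical part, and then the multipliers vanish because `(a, P)` is surjective. -/
lemma IsFiberwiseContact.isInvertible_liftSystem {a : E →L[ℝ] ℝ} {P : E →L[ℝ] G}
    {σ : E →L[ℝ] E →L[ℝ] ℝ} (h : IsFiberwiseContact a P σ) :
    (liftSystem a P σ).IsInvertible := by
  have hinj : Function.Injective (liftSystem a P σ) := by
    rw [injective_iff_map_eq_zero]
    rintro ⟨x, s, μ⟩ hp
    obtain ⟨hx, hPx⟩ := isHorizontal_of_liftSystem hp
    simp only at hx hPx
    have hx0 : x = 0 := h.nondegenerate x hx.1 hPx hx.2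
    subst hx0
    simp only [liftSystem_apply, Prod.mk_eq_zero] at hp
    have hp1 : ∀ y, s * a y + μ (P y) = 0 := fun y => by simpa using congr($(hp.1) y)
    obtain ⟨y, hy, hay⟩ := h.exists_vertical
    have hs : s = 0 := by simpa [hy, hay] using hp1 y
    have hμ : μ = 0 := by
      ext g
      obtain ⟨y, rfl⟩ := h.surjective g
      simpa [hs] using hp1 y
    simp [hs, hμ]
  -- Both sides have dimension `dim E + 1 + dim G`.
  have hdim : Module.finrank ℝ (E × ℝ × (G →L[ℝ] ℝ)) =
      Module.finrank ℝ ((E →L[ℝ] ℝ) × ℝ × G) := by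
    have hE : Module.finrank ℝ (E →L[ℝ] ℝ) = Module.finrank ℝ E := by
      rw [← (LinearMap.toContinuousLinearMap (𝕜 := ℝ) (E := E) (F' := ℝ)).finrank_eq]
      exact Subspace.dual_finrank_eq
    have hG : Module.finrank ℝ (G →L[ℝ] ℝ) = Module.finrank ℝ G := by
      rw [← (LinearMap.toContinuousLinearMap (𝕜 := ℝ) (E := G) (F' := ℝ)).finrank_eq]
      exact Subspace.dual_finrank_eq
    simp only [Module.finrank_prod, hE, hG]
  exact ⟨(LinearEquiv.ofInjectiveOfFinrankEq (liftSystem a P σ).toLinearMap hinj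
    hdim).toContinuousLinearEquiv, by ext <;> rfl⟩

lemma IsFiberwiseContact.exists_lift {a : E →L[ℝ] ℝ} {P : E →L[ℝ] G}
    {σ : E →L[ℝ] E →L[ℝ] ℝ} (h : IsFiberwiseContact a P σ) (g : G) :
    ∃ x, IsHorizontal a P σ x ∧ P x = g := by
  obtain ⟨T, hT⟩ := h.isInvertible_liftSystem
  refine ⟨(T.symm (0, 0, g)).1, isHorizontal_of_liftSystem (p := T.symm (0, 0, g)) ?_⟩
  rw [← hT]
  exact T.apply_symm_apply _

/-- Horizontal lifts can be chosen differentiably when the data are differentiable. -/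
lemma exists_differentiableAt_lift {a : E → (E →L[ℝ] ℝ)} {P : E → (E →L[ℝ] G)}
    {σ : E → (E →L[ℝ] E →L[ℝ] ℝ)} {g : E → G} {z : E}
    (ha : DifferentiableAt ℝ a z) (hP : DifferentiableAt ℝ P z) (hσ : DifferentiableAt ℝ σ z)
    (hg : DifferentiableAt ℝ g z) (h : IsFiberwiseContact (a z) (P z) (σ z)) :
    ∃ X : E → E, DifferentiableAt ℝ X z ∧
      ∀ᶠ w in 𝓝 z, IsHorizontal (a w) (P w) (σ w) (X w) ∧ P w (X w) = g w := by
  let T := fun w => liftSystem (a w) (P w) (σ w)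
  have hT : DifferentiableAt ℝ T z := differentiableAt_liftSystem ha hP hσ
  have hTz : (T z).IsInvertible := h.isInvertible_liftSystem
  have hinv : DifferentiableAt ℝ (fun w => (T w).inverse) z :=
    ((hTz.contDiffAt_map_inverse (n := 1)).differentiableAt one_ne_zero).comp z hT
  have hev : ∀ᶠ w in 𝓝 z, (T w).IsInvertible := by
    obtain ⟨e, he⟩ := hTz
    have h1 := hT.continuousAt.eventually (he ▸ ContinuousLinearEquiv.nhds e)
    filter_upwards [h1] with w hw
    exact hw
  refine ⟨fun w => ((T w).inverse (0, 0, g w)).1,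
    (hinv.clm_apply ((differentiableAt_const _).prodMk
      ((differentiableAt_const _).prodMk hg))).fst, ?_⟩
  filter_upwards [hev] with w hw
  apply isHorizontal_of_liftSystem
  obtain ⟨e, he⟩ := hw
  change T w _ = _
  rw [← he, ContinuousLinearMap.inverse_equiv]
  exact e.apply_symm_apply _

end LinearAlgebra

/-! ### One-forms in charts -/

section ChartForms

variable {E : Type*} [NormedAddCommGroup E] [NormedSpace ℝ E]
  {M : Type*} [TopologicalSpace M] [ChartedSpace E M]
  {E' : Type*} [NormedAddCommGroup E'] [NormedSpace ℝ E']
  {N : Type*} [TopologicalSpace N] [ChartedSpace E' N]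

lemma oneFormInChart_vectorSpace (α : ∀ z : E, TangentSpace 𝓘(ℝ, E) z →L[ℝ] ℝ) (z : E) :
    oneFormInChart α z = α := by
  funext w
  have h : mfderiv 𝓘(ℝ, E) 𝓘(ℝ, E) (id : E → E) w = ContinuousLinearMap.id ℝ _ := mfderiv_id
  exact (congrArg (fun L : E →L[ℝ] E => (α w : E →L[ℝ] ℝ).comp L) h).trans
    (ContinuousLinearMap.comp_id _)

lemma contDiffAt_writtenInExtChartAt {f : M → N} {m : M}
    (hf : ContMDiffAt 𝓘(ℝ, E) 𝓘(ℝ, E') 2 f m) :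
    ContDiffAt ℝ 2 (writtenInExtChartAt 𝓘(ℝ, E) 𝓘(ℝ, E') m f) (extChartAt 𝓘(ℝ, E) m m) := by
  have := ((contMDiffAt_iff).1 hf).2
  simpa [writtenInExtChartAt, contDiffWithinAt_univ] using this

lemma mfderiv_eq_fderiv_writtenInExtChartAt {f : M → N} {m : M}
    (hf : MDifferentiableAt 𝓘(ℝ, E) 𝓘(ℝ, E') f m) :
    mfderiv 𝓘(ℝ, E) 𝓘(ℝ, E') f m =
      fderiv ℝ (writtenInExtChartAt 𝓘(ℝ, E) 𝓘(ℝ, E') m f) (extChartAt 𝓘(ℝ, E) m m) := by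
  simpa [fderivWithin_univ] using hf.mfderiv

lemma writtenInExtChartAt_self (f : M → N) (m : M) :
    writtenInExtChartAt 𝓘(ℝ, E) 𝓘(ℝ, E') m f (extChartAt 𝓘(ℝ, E) m m) =
      extChartAt 𝓘(ℝ, E') (f m) (f m) := by
  simp [writtenInExtChartAt]

variable [IsManifold 𝓘(ℝ, E) ∞ M] [IsManifold 𝓘(ℝ, E') ∞ N]

lemma isManifold_one_of_infty : IsManifold 𝓘(ℝ, E) 1 M := IsManifold.of_le (n := ∞) (by simp)

/-- The differential of the preferred chart at its base point is the identity, so it drops out of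
the definition of `extDerivOneForm`. -/
lemma extDerivOneForm_eq_modelExtDeriv (α : ∀ m : M, TangentSpace 𝓘(ℝ, E) m →L[ℝ] ℝ) (m : M)
    (x y : TangentSpace 𝓘(ℝ, E) m) :
    extDerivOneForm α m x y =
      modelExtDeriv (oneFormInChart α m) (extChartAt 𝓘(ℝ, E) m m) x y := by
  have : IsManifold 𝓘(ℝ, E) 1 M := isManifold_one_of_infty
  have h := mfderiv_extChartAt_self (I := 𝓘(ℝ, E)) (x := m)
  have hx : ∀ u : TangentSpace 𝓘(ℝ, E) m,
      mfderiv 𝓘(ℝ, E) 𝓘(ℝ, E) (extChartAt 𝓘(ℝ, E) m) m u = u := fun u => congr($h u)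
  rw [extDerivOneForm_apply, hx, hx]
  rfl

lemma mfderiv_extChartAt_symm_comp {m m' : M} (h : m' ∈ (extChartAt 𝓘(ℝ, E) m).source)
    (u : E) :
    mfderiv 𝓘(ℝ, E) 𝓘(ℝ, E) (extChartAt 𝓘(ℝ, E) m).symm (extChartAt 𝓘(ℝ, E) m m')
      (mfderiv 𝓘(ℝ, E) 𝓘(ℝ, E) (extChartAt 𝓘(ℝ, E) m) m' u) = u := by
  have : IsManifold 𝓘(ℝ, E) 1 M := isManifold_one_of_infty
  have := mfderivWithin_extChartAt_symm_comp_mfderiv_extChartAt' h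
  simp only [modelWithCornersSelf_coe, Set.range_id, mfderivWithin_univ] at this
  exact congr($this u)

lemma mfderiv_extChartAt_comp_symm {m : M} {z : E} (h : z ∈ (extChartAt 𝓘(ℝ, E) m).target)
    (u : E) :
    mfderiv 𝓘(ℝ, E) 𝓘(ℝ, E) (extChartAt 𝓘(ℝ, E) m) ((extChartAt 𝓘(ℝ, E) m).symm z)
      (mfderiv 𝓘(ℝ, E) 𝓘(ℝ, E) (extChartAt 𝓘(ℝ, E) m).symm z u) = u := by
  have : IsManifold 𝓘(ℝ, E) 1 M := isManifold_one_of_infty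
  have := mfderiv_extChartAt_comp_mfderivWithin_extChartAt_symm h
  simp only [modelWithCornersSelf_coe, Set.range_id, mfderivWithin_univ] at this
  exact congr($this u)

lemma mfderiv_symm_comp_extChartAt {m : M} {z : E} (h : z ∈ (extChartAt 𝓘(ℝ, E) m).target)
    (u : E) :
    mfderiv 𝓘(ℝ, E) 𝓘(ℝ, E) (extChartAt 𝓘(ℝ, E) m).symm z
      (mfderiv 𝓘(ℝ, E) 𝓘(ℝ, E) (extChartAt 𝓘(ℝ, E) m) ((extChartAt 𝓘(ℝ, E) m).symm z) u) = u := by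
  have : IsManifold 𝓘(ℝ, E) 1 M := isManifold_one_of_infty
  have := mfderivWithin_extChartAt_symm_comp_mfderiv_extChartAt h
  simp only [modelWithCornersSelf_coe, Set.range_id, mfderivWithin_univ] at this
  exact congr($this u)

lemma oneFormInChart_apply_mfderiv (α : ∀ m : M, TangentSpace 𝓘(ℝ, E) m →L[ℝ] ℝ) {m m' : M}
    (h : m' ∈ (extChartAt 𝓘(ℝ, E) m).source) (u : TangentSpace 𝓘(ℝ, E) m') :
    oneFormInChart α m (extChartAt 𝓘(ℝ, E) m m')
      (mfderiv 𝓘(ℝ, E) 𝓘(ℝ, E) (extChartAt 𝓘(ℝ, E) m) m' u) = α m' u := by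
  let α' : M → (E →L[ℝ] ℝ) := α
  have h1 := mfderiv_extChartAt_symm_comp h u
  have h2 : α' ((extChartAt 𝓘(ℝ, E) m).symm (extChartAt 𝓘(ℝ, E) m m')) = α' m' :=
    congrArg α' ((extChartAt 𝓘(ℝ, E) m).left_inv h)
  exact (congr($h2 _)).trans (congrArg (α' m') h1)

lemma oneFormInChart_self (α : ∀ m : M, TangentSpace 𝓘(ℝ, E) m →L[ℝ] ℝ) {m : M}
    (x : TangentSpace 𝓘(ℝ, E) m) :
    oneFormInChart α m (extChartAt 𝓘(ℝ, E) m m) x = α m x := by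
  have : IsManifold 𝓘(ℝ, E) 1 M := isManifold_one_of_infty
  have h := oneFormInChart_apply_mfderiv α (mem_extChartAt_source (I := 𝓘(ℝ, E)) m) x
  have h' := mfderiv_extChartAt_self (I := 𝓘(ℝ, E)) (x := m)
  rw [h'] at h
  exact h

lemma contMDiffAt_extChartAt_symm {n : WithTop ℕ∞} (hn : n ≤ ∞) {m : M} {z : E}
    (h : z ∈ (extChartAt 𝓘(ℝ, E) m).target) :
    ContMDiffAt 𝓘(ℝ, E) 𝓘(ℝ, E) n (extChartAt 𝓘(ℝ, E) m).symm z := by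
  have := (contMDiffOn_extChartAt_symm (I := 𝓘(ℝ, E)) (n := ∞) m).contMDiffAt
    ((isOpen_extChartAt_target m).mem_nhds h)
  exact this.of_le hn

/-- Smoothness of a section of the cotangent bundle is smoothness of its chart expression: the
trivialization of the tangent bundle is the differential of the chart. -/
lemma IsSmoothOneForm.contDiffAt_oneFormInChart
    {α : ∀ m : M, TangentSpace 𝓘(ℝ, E) m →L[ℝ] ℝ} (hα : IsSmoothOneForm α) (m : M) :
    ContDiffAt ℝ 2 (oneFormInChart α m) (extChartAt 𝓘(ℝ, E) m m) := by
  have : IsManifold 𝓘(ℝ, E) 1 M := isManifold_one_of_infty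
  have h1 := ((contMDiffAt_hom_bundle _).1 (hα m)).2
  have h2 := ContMDiffAt.comp_of_eq h1
    (contMDiffAt_extChartAt_symm le_rfl (mem_extChartAt_target (I := 𝓘(ℝ, E)) m))
    (extChartAt_to_inv m)
  have h3 := (h2.of_le (m := 2) (by norm_cast)).contDiffAt
  refine h3.congr_of_eventuallyEq ?_
  filter_upwards [(isOpen_extChartAt_target m).mem_nhds
    (mem_extChartAt_target (I := 𝓘(ℝ, E)) m)] with z hz
  have hz' : (extChartAt 𝓘(ℝ, E) m).symm z ∈ (chartAt E m).source := by
    simpa using (extChartAt 𝓘(ℝ, E) m).map_target hz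
  have hS := TangentBundle.symmL_trivializationAt (I := 𝓘(ℝ, E)) hz'
  simp only [modelWithCornersSelf_coe, Set.range_id, mfderivWithin_univ] at hS
  let D : E → (E →L[ℝ] E) := fun w => mfderiv 𝓘(ℝ, E) 𝓘(ℝ, E) (extChartAt 𝓘(ℝ, E) m).symm w
  have hD : D (extChartAt 𝓘(ℝ, E) m ((extChartAt 𝓘(ℝ, E) m).symm z)) = D z :=
    congrArg D ((extChartAt 𝓘(ℝ, E) m).right_inv hz)
  ext u
  have hS' : D z u = (trivializationAt E (TangentSpace 𝓘(ℝ, E)) m).symmL ℝ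
      ((extChartAt 𝓘(ℝ, E) m).symm z) u := (congr($(hS.trans hD) u)).symm
  have htriv : ∀ (p : M) (c : ℝ),
      (trivializationAt ℝ (Bundle.Trivial M ℝ) m).continuousLinearMapAt ℝ p c = c := by
    intro p c
    simp
  simp only [Function.comp_apply, ContinuousLinearMap.inCoordinates,
    ContinuousLinearMap.comp_apply]
  exact (congrArg (α ((extChartAt 𝓘(ℝ, E) m).symm z) : E →L[ℝ] ℝ) hS').trans (htriv _ _).symm

/-- The chart expression of a pulled back one-form. -/
lemma oneFormInChart_pullback (α : ∀ n : N, TangentSpace 𝓘(ℝ, E') n →L[ℝ] ℝ) {f : M → N} {m : M}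
    (hf : ContMDiffAt 𝓘(ℝ, E) 𝓘(ℝ, E') 2 f m) :
    oneFormInChart (fun m' => (α (f m')).comp (mfderiv 𝓘(ℝ, E) 𝓘(ℝ, E') f m')) m
      =ᶠ[𝓝 (extChartAt 𝓘(ℝ, E) m m)]
    fun z => (oneFormInChart α (f m) (writtenInExtChartAt 𝓘(ℝ, E) 𝓘(ℝ, E') m f z)).comp
      (fderiv ℝ (writtenInExtChartAt 𝓘(ℝ, E) 𝓘(ℝ, E') m f) z) := by
  have : IsManifold 𝓘(ℝ, E) 1 M := isManifold_one_of_infty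
  have : IsManifold 𝓘(ℝ, E') 1 N := isManifold_one_of_infty
  have : IsManifold 𝓘(ℝ, E) 2 M := IsManifold.of_le (n := ∞) (by norm_cast)
  have : IsManifold 𝓘(ℝ, E') 2 N := IsManifold.of_le (n := ∞) (by norm_cast)
  have hφ := (contMDiffAt_extChartAt_symm (n := ∞) le_rfl
    (mem_extChartAt_target (I := 𝓘(ℝ, E)) m)).continuousAt
  have hφm := extChartAt_to_inv (I := 𝓘(ℝ, E)) m
  have h1 : ∀ᶠ m' in 𝓝 m, ContMDiffAt 𝓘(ℝ, E) 𝓘(ℝ, E') 2 f m' ∧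
      f m' ∈ (extChartAt 𝓘(ℝ, E') (f m)).source :=
    ((contMDiffAt_iff_contMDiffAt_nhds (by simp)).1 hf).and (hf.continuousAt.eventually
      (extChartAt_source_mem_nhds (I := 𝓘(ℝ, E')) (f m)))
  have h2 : Tendsto (extChartAt 𝓘(ℝ, E) m).symm (𝓝 (extChartAt 𝓘(ℝ, E) m m)) (𝓝 m) := by
    simpa only [ContinuousAt, hφm] using hφ
  filter_upwards [h2.eventually h1, (isOpen_extChartAt_target m).mem_nhds
    (mem_extChartAt_target (I := 𝓘(ℝ, E)) m)] with z hz hzt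
  have hψ : MDifferentiableAt 𝓘(ℝ, E') 𝓘(ℝ, E') (extChartAt 𝓘(ℝ, E') (f m))
      (f ((extChartAt 𝓘(ℝ, E) m).symm z)) := mdifferentiableAt_extChartAt (by simpa using hz.2)
  have hfz := hz.1.mdifferentiableAt (by norm_num)
  have hφz := (contMDiffAt_extChartAt_symm (n := ∞) le_rfl hzt).mdifferentiableAt (by simp)
  have hcomp : ∀ u, fderiv ℝ (writtenInExtChartAt 𝓘(ℝ, E) 𝓘(ℝ, E') m f) z u =
      mfderiv 𝓘(ℝ, E') 𝓘(ℝ, E') (extChartAt 𝓘(ℝ, E') (f m))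
        (f ((extChartAt 𝓘(ℝ, E) m).symm z))
        (mfderiv 𝓘(ℝ, E) 𝓘(ℝ, E') f ((extChartAt 𝓘(ℝ, E) m).symm z)
          (mfderiv 𝓘(ℝ, E) 𝓘(ℝ, E) (extChartAt 𝓘(ℝ, E) m).symm z u)) := by
    intro u
    rw [← mfderiv_eq_fderiv]
    have e1 := mfderiv_comp z hψ (hfz.comp z hφz)
    have e2 := mfderiv_comp z hfz hφz
    rw [e2] at e1
    exact congr($e1 u)
  ext u
  rw [ContinuousLinearMap.comp_apply, hcomp]
  exact (oneFormInChart_apply_mfderiv α hz.2 _).symm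

lemma differentiableAt_oneFormInChart_pullback
    {α : ∀ n : N, TangentSpace 𝓘(ℝ, E') n →L[ℝ] ℝ} (hα : IsSmoothOneForm α) {f : M → N} {m : M}
    (hf : ContMDiffAt 𝓘(ℝ, E) 𝓘(ℝ, E') 2 f m) :
    DifferentiableAt ℝ
      (oneFormInChart (fun m' => (α (f m')).comp (mfderiv 𝓘(ℝ, E) 𝓘(ℝ, E') f m')) m)
      (extChartAt 𝓘(ℝ, E) m m) := by
  refine DifferentiableAt.congr_of_eventuallyEq ?_ (oneFormInChart_pullback α hf)
  refine (hasFDerivAt_pullback (contDiffAt_writtenInExtChartAt hf) ?_).differentiableAt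
  rw [writtenInExtChartAt_self]
  exact (hα.contDiffAt_oneFormInChart (f m)).differentiableAt (by norm_num)

/-- Naturality of the exterior derivative: `d (f^* α) = f^* (dα)`. -/
lemma extDerivOneForm_pullback
    {α : ∀ n : N, TangentSpace 𝓘(ℝ, E') n →L[ℝ] ℝ} (hα : IsSmoothOneForm α) {f : M → N} {m : M}
    (hf : ContMDiffAt 𝓘(ℝ, E) 𝓘(ℝ, E') 2 f m) (x y : TangentSpace 𝓘(ℝ, E) m) :
    extDerivOneForm (fun m' => (α (f m')).comp (mfderiv 𝓘(ℝ, E) 𝓘(ℝ, E') f m')) m x y =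
      extDerivOneForm α (f m) (mfderiv 𝓘(ℝ, E) 𝓘(ℝ, E') f m x)
        (mfderiv 𝓘(ℝ, E) 𝓘(ℝ, E') f m y) := by
  rw [extDerivOneForm_eq_modelExtDeriv, extDerivOneForm_eq_modelExtDeriv,
    modelExtDeriv_congr (oneFormInChart_pullback α hf),
    mfderiv_eq_fderiv_writtenInExtChartAt (hf.mdifferentiableAt (by norm_num))]
  have hα' := (hα.contDiffAt_oneFormInChart (f m)).differentiableAt (by norm_num)
  rw [← writtenInExtChartAt_self (E := E)] at hα'
  have := modelExtDeriv_pullback (contDiffAt_writtenInExtChartAt hf) hα' x y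
  rw [writtenInExtChartAt_self] at this
  exact this

/-- The exterior derivative at all points of a chart domain can be computed in that chart, although
`extDerivOneForm` uses the preferred chart at each point: this is naturality for the inverse of the
chart. -/
lemma extDerivOneForm_extChartAt_symm
    {α : ∀ m : M, TangentSpace 𝓘(ℝ, E) m →L[ℝ] ℝ} (hα : IsSmoothOneForm α) {m : M} {z : E}
    (hz : z ∈ (extChartAt 𝓘(ℝ, E) m).target) (x y : E) :
    extDerivOneForm α ((extChartAt 𝓘(ℝ, E) m).symm z)
      (mfderiv 𝓘(ℝ, E) 𝓘(ℝ, E) (extChartAt 𝓘(ℝ, E) m).symm z x)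
      (mfderiv 𝓘(ℝ, E) 𝓘(ℝ, E) (extChartAt 𝓘(ℝ, E) m).symm z y) =
    modelExtDeriv (oneFormInChart α m) z x y := by
  have h := extDerivOneForm_pullback hα
    (contMDiffAt_extChartAt_symm (n := 2) (by norm_cast) hz) x y
  refine h.symm.trans ((extDerivOneForm_eq_modelExtDeriv _ _ _ _).trans ?_)
  rw [oneFormInChart_vectorSpace]
  rfl

/-- Defining forms of the same distribution have proportional exterior derivatives along it. -/
lemma exists_extDerivOneForm_eq_smul {α β : ∀ m : M, TangentSpace 𝓘(ℝ, E) m →L[ℝ] ℝ} {m : M}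
    (hα : DifferentiableAt ℝ (oneFormInChart α m) (extChartAt 𝓘(ℝ, E) m m))
    (hβ : DifferentiableAt ℝ (oneFormInChart β m) (extChartAt 𝓘(ℝ, E) m m))
    (hker : ∀ m' (x : TangentSpace 𝓘(ℝ, E) m'), α m' x = 0 ↔ β m' x = 0) (h0 : α m ≠ 0) :
    ∃ c : ℝ, c ≠ 0 ∧ ∀ x y : TangentSpace 𝓘(ℝ, E) m, α m x = 0 → α m y = 0 →
      extDerivOneForm β m x y = c * extDerivOneForm α m x y := by
  have : IsManifold 𝓘(ℝ, E) 1 M := isManifold_one_of_infty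
  obtain ⟨c, hc, h⟩ := modelExtDeriv_of_ker_eq hα hβ
    (Eventually.of_forall fun z x => hker _ _) (fun h => h0 <| by
      ext x; rw [← oneFormInChart_self α x, h]; rfl)
  refine ⟨c, hc, fun x y hx hy => ?_⟩
  rw [extDerivOneForm_eq_modelExtDeriv, extDerivOneForm_eq_modelExtDeriv]
  exact h x y ((oneFormInChart_self α x).trans hx) ((oneFormInChart_self α y).trans hy)

end ChartForms

/-! ### The vertical and horizontal spaces of a contact fiber bundle -/

section BundleGeometry

variable {EB : Type*} [NormedAddCommGroup EB] [NormedSpace ℝ EB]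
  {B : Type*} [TopologicalSpace B] [ChartedSpace EB B]
  {EF : Type*} [NormedAddCommGroup EF] [NormedSpace ℝ EF]
  {F : Type*} [TopologicalSpace F] [ChartedSpace EF F]
  {EM : Type*} [NormedAddCommGroup EM] [NormedSpace ℝ EM]
  {M : Type*} [TopologicalSpace M] [ChartedSpace EM M]
  {π : M → B}

lemma IsSmoothTrivialization.contMDiff_fiberParam {e : Bundle.Trivialization F π}
    (he : IsSmoothTrivialization (EB := EB) (EF := EF) (EM := EM) e) {b : B}
    (hb : b ∈ e.baseSet) : ContMDiff 𝓘(ℝ, EF) 𝓘(ℝ, EM) ∞ (fiberParam e b) := by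
  intro f
  have h1 : ContMDiffAt (𝓘(ℝ, EB).prod 𝓘(ℝ, EF)) 𝓘(ℝ, EM) ∞
      e.toOpenPartialHomeomorph.symm (b, f) :=
    he.2.contMDiffAt (e.open_target.mem_nhds (e.mem_target.2 hb))
  exact ContMDiffAt.comp f h1 (contMDiffAt_const.prodMk contMDiffAt_id)

lemma mfderiv_proj_fiberParam (hπ : ContMDiff 𝓘(ℝ, EM) 𝓘(ℝ, EB) ∞ π)
    {e : Bundle.Trivialization F π}
    (he : IsSmoothTrivialization (EB := EB) (EF := EF) (EM := EM) e) {b : B}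
    (hb : b ∈ e.baseSet) (f : F) (x : TangentSpace 𝓘(ℝ, EF) f) :
    mfderiv 𝓘(ℝ, EM) 𝓘(ℝ, EB) π (fiberParam e b f)
      (mfderiv 𝓘(ℝ, EF) 𝓘(ℝ, EM) (fiberParam e b) f x) = 0 := by
  have h1 : π ∘ fiberParam e b = fun _ => b := funext fun f => e.proj_symm_apply' hb
  have h2 := mfderiv_comp f ((hπ (fiberParam e b f)).mdifferentiableAt (by simp))
    ((he.contMDiff_fiberParam hb f).mdifferentiableAt (by simp))
  rw [h1, mfderiv_const] at h2
  exact congr($h2 x).symm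

/-- The projection is a submersion, since it has local sections through every point. -/
lemma surjective_mfderiv_proj (hπ : ContMDiff 𝓘(ℝ, EM) 𝓘(ℝ, EB) ∞ π)
    {e : Bundle.Trivialization F π}
    (he : IsSmoothTrivialization (EB := EB) (EF := EF) (EM := EM) e) {b : B}
    (hb : b ∈ e.baseSet) (f : F) (x : EB) :
    ∃ u : EM, mfderiv 𝓘(ℝ, EM) 𝓘(ℝ, EB) π (fiberParam e b f) u = x := by
  let s : B → M := fun b' => e.toOpenPartialHomeomorph.symm (b', f)
  have hs : MDifferentiableAt 𝓘(ℝ, EB) 𝓘(ℝ, EM) s b := by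
    have h1 : ContMDiffAt (𝓘(ℝ, EB).prod 𝓘(ℝ, EF)) 𝓘(ℝ, EM) ∞
        e.toOpenPartialHomeomorph.symm (b, f) :=
      he.2.contMDiffAt (e.open_target.mem_nhds (e.mem_target.2 hb))
    exact (ContMDiffAt.comp b h1 (contMDiffAt_id.prodMk contMDiffAt_const)).mdifferentiableAt
      (by simp)
  have h1 : π ∘ s =ᶠ[𝓝 b] id := by
    filter_upwards [e.open_baseSet.mem_nhds hb] with b' hb'
    exact e.proj_symm_apply' hb'
  have h2 := mfderiv_comp b ((hπ (s b)).mdifferentiableAt (by simp)) hs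
  rw [h1.mfderiv_eq, mfderiv_id] at h2
  exact ⟨mfderiv 𝓘(ℝ, EB) 𝓘(ℝ, EM) s b x, congr($h2 x).symm⟩

/-- Vertical vectors are tangent to the fiber. -/
lemma exists_mfderiv_fiberParam_eq {e : Bundle.Trivialization F π}
    (he : IsSmoothTrivialization (EB := EB) (EF := EF) (EM := EM) e) {b : B}
    (hb : b ∈ e.baseSet) (f : F) {x : EM}
    (hx : mfderiv 𝓘(ℝ, EM) 𝓘(ℝ, EB) π (fiberParam e b f) x = 0) :
    ∃ u : TangentSpace 𝓘(ℝ, EF) f, mfderiv 𝓘(ℝ, EF) 𝓘(ℝ, EM) (fiberParam e b) f u = x := by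
  set m := fiberParam e b f with hm
  have hbf : (b, f) ∈ e.target := e.mem_target.2 hb
  have hem : e m = (b, f) := e.apply_symm_apply hbf
  have hms : m ∈ e.source := e.map_target hbf
  have hsd : MDifferentiableAt (𝓘(ℝ, EB).prod 𝓘(ℝ, EF)) 𝓘(ℝ, EM)
      e.toOpenPartialHomeomorph.symm (b, f) :=
    (he.2.contMDiffAt (e.open_target.mem_nhds hbf)).mdifferentiableAt (by simp)
  have hed : MDifferentiableAt 𝓘(ℝ, EM) (𝓘(ℝ, EB).prod 𝓘(ℝ, EF)) e m :=
    (he.1.contMDiffAt (e.open_source.mem_nhds hms)).mdifferentiableAt (by simp)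
  have hid : e.toOpenPartialHomeomorph.symm ∘ e =ᶠ[𝓝 m] id := by
    filter_upwards [e.open_source.mem_nhds hms] with m' hm'
    exact e.toOpenPartialHomeomorph.left_inv hm'
  have h1 := mfderiv_comp_of_eq hsd hed hem
  rw [hid.mfderiv_eq, mfderiv_id] at h1
  have h2 := mfderiv_comp_of_eq (mdifferentiableAt_fst (I := 𝓘(ℝ, EB)) (I' := 𝓘(ℝ, EF))) hed hem
  rw [(e.coe_fst_eventuallyEq_proj hms).mfderiv_eq, mfderiv_fst] at h2
  let v : EB × EF := mfderiv 𝓘(ℝ, EM) (𝓘(ℝ, EB).prod 𝓘(ℝ, EF)) e m x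
  have hv : v.1 = 0 := congr($h2 x).symm.trans hx
  have h3 := mfderiv_prod_eq_add_apply hsd (v := v)
  refine ⟨v.2, ?_⟩
  let D : B × F → (EB × EF →L[ℝ] EM) := fun p =>
    mfderiv (𝓘(ℝ, EB).prod 𝓘(ℝ, EF)) 𝓘(ℝ, EM) e.toOpenPartialHomeomorph.symm p
  have hD : D (e m) = D (b, f) := congrArg D hem
  have h4 : mfderiv (𝓘(ℝ, EB).prod 𝓘(ℝ, EF)) 𝓘(ℝ, EM)
      e.toOpenPartialHomeomorph.symm (b, f) v = x :=
    (congr($hD v)).symm.trans congr($h1 x).symm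
  rw [h4] at h3
  have h5 : mfderiv 𝓘(ℝ, EB) 𝓘(ℝ, EM)
      (fun z => e.toOpenPartialHomeomorph.symm (z, f)) b v.1 = 0 := by
    rw [hv]; exact map_zero _
  have h6 := h3.trans (congrArg (fun t : EM => t + _) h5)
  exact (h6.trans (zero_add _)).symm

variable [IsManifold 𝓘(ℝ, EF) ∞ F] [IsManifold 𝓘(ℝ, EM) ∞ M]
  {ξ : ∀ m : M, Submodule ℝ (TangentSpace 𝓘(ℝ, EM) m)}
  {α : ∀ m : M, TangentSpace 𝓘(ℝ, EM) m →L[ℝ] ℝ}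

/-- The restriction of `dα` to `ξ ∩ ker dπ` is nondegenerate, because it is proportional to the
exterior derivative of the contact form given on the fiber. -/
lemma isFiberwiseContact_fiberParam (hπ : ContMDiff 𝓘(ℝ, EM) 𝓘(ℝ, EB) ∞ π)
    (hα : IsDefiningForm ξ α) {e : Bundle.Trivialization F π}
    (he : IsSmoothTrivialization (EB := EB) (EF := EF) (EM := EM) e) {b : B}
    (hb : b ∈ e.baseSet) (hF : IsContactStructure (E := EF) (fiberDistribution ξ e b)) (f : F) :
    IsFiberwiseContact (E := EM) (G := EB) (α (fiberParam e b f))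
      (mfderiv 𝓘(ℝ, EM) 𝓘(ℝ, EB) π (fiberParam e b f))
      (extDerivOneForm α (fiberParam e b f)) := by
  obtain ⟨β, hβ, hnd⟩ := hF
  have hj : ContMDiffAt 𝓘(ℝ, EF) 𝓘(ℝ, EM) 2 (fiberParam e b) f :=
    (he.contMDiff_fiberParam hb f).of_le (by norm_cast)
  have hker : ∀ f' (u : TangentSpace 𝓘(ℝ, EF) f'), β f' u = 0 ↔
      (α (fiberParam e b f')).comp (mfderiv 𝓘(ℝ, EF) 𝓘(ℝ, EM) (fiberParam e b) f') u = 0 := by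
    intro f' u
    rw [← hβ.mem_iff f' u]
    exact hα.mem_iff _ _
  refine ⟨surjective_mfderiv_proj hπ he hb f, ?_, fun x hx hPx hxy => ?_⟩
  · obtain ⟨u, hu⟩ : ∃ u, β f u ≠ 0 := by
      by_contra! h
      exact hβ.ne_zero f (ContinuousLinearMap.ext h)
    exact ⟨mfderiv 𝓘(ℝ, EF) 𝓘(ℝ, EM) (fiberParam e b) f u,
      mfderiv_proj_fiberParam hπ he hb f u, fun h => hu ((hker f u).2 h)⟩
  · obtain ⟨u, hu⟩ := exists_mfderiv_fiberParam_eq he hb f hPx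
    obtain ⟨c, hc, hcd⟩ := exists_extDerivOneForm_eq_smul
      ((hβ.smooth.contDiffAt_oneFormInChart f).differentiableAt (by norm_num))
      (differentiableAt_oneFormInChart_pullback hα.smooth hj) hker (hβ.ne_zero f)
    have hβu : β f u = 0 := (hker f u).2 ((congrArg (α (fiberParam e b f)) hu).trans hx)
    have hu0 : u = 0 := by
      refine hnd f u ((hβ.mem_iff f u).2 hβu) fun w hw => ?_
      have hβw := (hβ.mem_iff f w).1 hw
      have h1 := hcd u w hβu hβw
      rw [extDerivOneForm_pullback hα.smooth hj] at h1
      have h2 := hxy (mfderiv 𝓘(ℝ, EF) 𝓘(ℝ, EM) (fiberParam e b) f w) ((hker f w).1 hβw)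
        (mfderiv_proj_fiberParam hπ he hb f w)
      have h3 := (congrArg (fun t => extDerivOneForm α (fiberParam e b f) t
        (mfderiv 𝓘(ℝ, EF) 𝓘(ℝ, EM) (fiberParam e b) f w)) hu).trans h2
      exact (mul_eq_zero.1 (h1.symm.trans h3)).resolve_left hc
    rw [← hu, hu0]
    exact map_zero _

lemma IsContactFiberBundle.isFiberwiseContact
    (hξ : IsContactFiberBundle (EB := EB) (EF := EF) F π ξ) (hα : IsDefiningForm ξ α) (m : M) :
    IsFiberwiseContact (E := EM) (G := EB) (α m) (mfderiv 𝓘(ℝ, EM) 𝓘(ℝ, EB) π m)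
      (extDerivOneForm α m) := by
  obtain ⟨e, hb, he, hF⟩ := hξ.contact_fiber (π m)
  have hm : fiberParam e (π m) (e m).2 = m := e.symm_apply_mk_proj (e.mem_source.2 hb)
  have h := isFiberwiseContact_fiberParam hξ.smooth_proj hα he hb hF (e m).2
  rwa [hm] at h

/-- Membership in the contact connection can be tested on a single defining form. -/
lemma mem_contactConnection_iff (hα : IsDefiningForm ξ α) (m : M)
    (x : TangentSpace 𝓘(ℝ, EM) m) :
    x ∈ contactConnection EB π ξ m ↔
      IsHorizontal (E := EM) (G := EB) (α m) (mfderiv 𝓘(ℝ, EM) 𝓘(ℝ, EB) π m)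
        (extDerivOneForm α m) x := by
  constructor
  · rintro ⟨hx, h⟩
    exact ⟨(hα.mem_iff m x).1 hx, fun y hy hPy => h α hα y ⟨(hα.mem_iff m y).2 hy, hPy⟩⟩
  · rintro ⟨hx, h⟩
    refine ⟨(hα.mem_iff m x).2 hx, fun β hβ y hy => ?_⟩
    obtain ⟨c, -, hc⟩ := exists_extDerivOneForm_eq_smul
      ((hα.smooth.contDiffAt_oneFormInChart m).differentiableAt (by norm_num))
      ((hβ.smooth.contDiffAt_oneFormInChart m).differentiableAt (by norm_num))
      (fun m' u => (hα.mem_iff m' u).symm.trans (hβ.mem_iff m' u)) (hα.ne_zero m)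
    have hy' := (hα.mem_iff m y).1 hy.1
    rw [hc x y hx hy']
    exact mul_eq_zero_of_right c (h y hy' hy.2)

variable [FiniteDimensional ℝ EB] [FiniteDimensional ℝ EM]

/-- Horizontal lifts exist, so `horizontalLift` never takes its default value. -/
lemma IsContactFiberBundle.horizontalLift_spec
    (hξ : IsContactFiberBundle (EB := EB) (EF := EF) F π ξ) (hα : IsDefiningForm ξ α)
    (v : ∀ b : B, TangentSpace 𝓘(ℝ, EB) b) (m : M) :
    IsHorizontal (E := EM) (G := EB) (α m) (mfderiv 𝓘(ℝ, EM) 𝓘(ℝ, EB) π m)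
        (extDerivOneForm α m) (horizontalLift π (contactConnection EB π ξ) v m) ∧
      mfderiv 𝓘(ℝ, EM) 𝓘(ℝ, EB) π m (horizontalLift π (contactConnection EB π ξ) v m) =
        v (π m) := by
  have h : ∃ u ∈ contactConnection EB π ξ m, mfderiv 𝓘(ℝ, EM) 𝓘(ℝ, EB) π m u = v (π m) := by
    obtain ⟨u, hu, huv⟩ := (hξ.isFiberwiseContact hα m).exists_lift (v (π m))
    exact ⟨u, (mem_contactConnection_iff hα m u).2 hu, huv⟩
  rw [horizontalLift, dif_pos h]
  exact ⟨(mem_contactConnection_iff hα m _).1 h.choose_spec.1, h.choose_spec.2⟩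

end BundleGeometry

/-! ### Curvature of the contact connection -/

section Curvature

variable {EM : Type*} [NormedAddCommGroup EM] [NormedSpace ℝ EM]
  {M : Type*} [TopologicalSpace M] [ChartedSpace EM M] [IsManifold 𝓘(ℝ, EM) ∞ M]

/-- The vector field `V` expressed in the chart of `M` at `m`, that is, its pushforward by the
chart. It is only meaningful on the target of the chart. -/
noncomputable def fieldInChart (V : ∀ m : M, TangentSpace 𝓘(ℝ, EM) m) (m : M) : EM → EM := fun z =>
  mfderiv 𝓘(ℝ, EM) 𝓘(ℝ, EM) (extChartAt 𝓘(ℝ, EM) m) ((extChartAt 𝓘(ℝ, EM) m).symm z)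
    (V ((extChartAt 𝓘(ℝ, EM) m).symm z))

lemma fieldInChart_self (V : ∀ m : M, TangentSpace 𝓘(ℝ, EM) m) (m : M) :
    fieldInChart V m (extChartAt 𝓘(ℝ, EM) m m) = V m := by
  have : IsManifold 𝓘(ℝ, EM) 1 M := isManifold_one_of_infty
  let W : M → EM := fun m' => mfderiv 𝓘(ℝ, EM) 𝓘(ℝ, EM) (extChartAt 𝓘(ℝ, EM) m) m' (V m')
  have h : W ((extChartAt 𝓘(ℝ, EM) m).symm (extChartAt 𝓘(ℝ, EM) m m)) = W m :=
    congrArg W (extChartAt_to_inv m)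
  have h' := mfderiv_extChartAt_self (I := 𝓘(ℝ, EM)) (x := m)
  exact h.trans congr($h' (V m))

lemma oneFormInChart_fieldInChart (α : ∀ m : M, TangentSpace 𝓘(ℝ, EM) m →L[ℝ] ℝ)
    (V : ∀ m : M, TangentSpace 𝓘(ℝ, EM) m) {m : M} {z : EM}
    (hz : z ∈ (extChartAt 𝓘(ℝ, EM) m).target) :
    oneFormInChart α m z (fieldInChart V m z) =
      α ((extChartAt 𝓘(ℝ, EM) m).symm z) (V ((extChartAt 𝓘(ℝ, EM) m).symm z)) :=
  congrArg (α ((extChartAt 𝓘(ℝ, EM) m).symm z) : EM →L[ℝ] ℝ)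
    (mfderiv_symm_comp_extChartAt hz _)

lemma mpullbackWithin_eq_fieldInChart (V : ∀ m : M, TangentSpace 𝓘(ℝ, EM) m) {m : M} {z : EM}
    (hz : z ∈ (extChartAt 𝓘(ℝ, EM) m).target) :
    VectorField.mpullbackWithin 𝓘(ℝ, EM) 𝓘(ℝ, EM) (extChartAt 𝓘(ℝ, EM) m).symm V
      (Set.range 𝓘(ℝ, EM)) z = fieldInChart V m z := by
  have : IsManifold 𝓘(ℝ, EM) 1 M := isManifold_one_of_infty
  have hinv := isInvertible_mfderivWithin_extChartAt_symm (I := 𝓘(ℝ, EM)) hz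
  rw [VectorField.mpullbackWithin_apply]
  refine (hinv.inverse_apply_eq).2 ?_
  simp only [modelWithCornersSelf_coe, Set.range_id, mfderivWithin_univ]
  exact (mfderiv_symm_comp_extChartAt hz _).symm

/-- The differential of the preferred chart at its base point is the identity, hence no pullback on
the right-hand side. -/
lemma mlieBracket_eq_lieBracket_fieldInChart (V W : ∀ m : M, TangentSpace 𝓘(ℝ, EM) m) (m : M) :
    VectorField.mlieBracket 𝓘(ℝ, EM) V W m =
      VectorField.lieBracket ℝ (fieldInChart V m) (fieldInChart W m)
        (extChartAt 𝓘(ℝ, EM) m m) := by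
  have : IsManifold 𝓘(ℝ, EM) 1 M := isManifold_one_of_infty
  have hev : ∀ U : ∀ m : M, TangentSpace 𝓘(ℝ, EM) m,
      (VectorField.mpullbackWithin 𝓘(ℝ, EM) 𝓘(ℝ, EM) (extChartAt 𝓘(ℝ, EM) m).symm U
        (Set.range 𝓘(ℝ, EM)) : EM → EM) =ᶠ[𝓝 (extChartAt 𝓘(ℝ, EM) m m)] fieldInChart U m := by
    intro U
    filter_upwards [(isOpen_extChartAt_target m).mem_nhds
      (mem_extChartAt_target (I := 𝓘(ℝ, EM)) m)] with z hz
    exact mpullbackWithin_eq_fieldInChart U hz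
  have h := Filter.EventuallyEq.lieBracket_vectorField_eq (𝕜 := ℝ) (hev V) (hev W)
  have hinv : ∀ T : EM →L[ℝ] EM, T = .id ℝ EM → ∀ u, T.inverse u = u := by
    rintro _ rfl u
    rw [ContinuousLinearMap.inverse_id]
    rfl
  rw [← h, ← VectorField.mlieBracketWithin_univ, VectorField.mlieBracketWithin_apply]
  refine (hinv _ mfderiv_extChartAt_self _).trans ?_
  have hset : (extChartAt 𝓘(ℝ, EM) m).symm ⁻¹' Set.univ ∩ Set.range 𝓘(ℝ, EM) = Set.univ := by
    simp
  rw [hset]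
  exact congrFun VectorField.lieBracketWithin_univ _

/-- Cartan's formula on a manifold for vector fields that are annihilated by the one-form. -/
lemma extDerivOneForm_eq_neg_mlieBracket {α : ∀ m : M, TangentSpace 𝓘(ℝ, EM) m →L[ℝ] ℝ}
    (hα : IsSmoothOneForm α) {V W : ∀ m : M, TangentSpace 𝓘(ℝ, EM) m} {m : M}
    (hV : DifferentiableAt ℝ (fieldInChart V m) (extChartAt 𝓘(ℝ, EM) m m))
    (hW : DifferentiableAt ℝ (fieldInChart W m) (extChartAt 𝓘(ℝ, EM) m m))
    (hV0 : ∀ m', α m' (V m') = 0) (hW0 : ∀ m', α m' (W m') = 0) :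
    extDerivOneForm α m (V m) (W m) = -α m (VectorField.mlieBracket 𝓘(ℝ, EM) V W m) := by
  have : IsManifold 𝓘(ℝ, EM) 1 M := isManifold_one_of_infty
  have hev : ∀ U : ∀ m : M, TangentSpace 𝓘(ℝ, EM) m, (∀ m', α m' (U m') = 0) →
      ∀ᶠ z in 𝓝 (extChartAt 𝓘(ℝ, EM) m m), oneFormInChart α m z (fieldInChart U m z) = 0 := by
    intro U hU
    filter_upwards [(isOpen_extChartAt_target m).mem_nhds
      (mem_extChartAt_target (I := 𝓘(ℝ, EM)) m)] with z hz
    rw [oneFormInChart_fieldInChart α U hz, hU]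
  have h := modelExtDeriv_eq_neg_lieBracket
    ((hα.contDiffAt_oneFormInChart m).differentiableAt (by norm_num)) hV hW (hev V hV0) (hev W hW0)
  rw [fieldInChart_self, fieldInChart_self, ← mlieBracket_eq_lieBracket_fieldInChart] at h
  rw [extDerivOneForm_eq_modelExtDeriv, h, oneFormInChart_self]

lemma IsSmoothVectorField.mdifferentiableAt_mfderiv_extChartAt
    {V : ∀ m : M, TangentSpace 𝓘(ℝ, EM) m} (hV : IsSmoothVectorField V) (m : M) :
    MDifferentiableAt 𝓘(ℝ, EM) 𝓘(ℝ, EM) (fun m' => (mfderiv 𝓘(ℝ, EM) 𝓘(ℝ, EM)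
      (extChartAt 𝓘(ℝ, EM) m) m' (V m') : EM)) m := by
  have : IsManifold 𝓘(ℝ, EM) 1 M := isManifold_one_of_infty
  have h := ((Bundle.contMDiffAt_section m).1 (hV m)).mdifferentiableAt (by simp)
  refine h.congr_of_eventuallyEq ?_
  filter_upwards [(chartAt EM m).open_source.mem_nhds (mem_chart_source EM m)] with m' hm'
  have h1 := TangentBundle.continuousLinearMapAt_trivializationAt (I := 𝓘(ℝ, EM)) hm'
  rw [← h1]
  exact Bundle.Trivialization.continuousLinearMapAt_apply_of_mem _ _ (by simpa using hm') _

/-- A bump function turns a local extension of a tangent vector into a global smooth vector field,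
so `extendVector` never takes its default value. -/
lemma extendVector_spec [T2Space M] [FiniteDimensional ℝ EM] {m : M}
    (x : TangentSpace 𝓘(ℝ, EM) m) :
    IsSmoothVectorField (extendVector x) ∧ extendVector x m = x := by
  have h : ∃ v : ∀ m' : M, TangentSpace 𝓘(ℝ, EM) m', IsSmoothVectorField v ∧ v m = x := by
    obtain ⟨s, hs, hsx⟩ := FiberBundle.exists_contMDiffOn_extend (k := ∞) 𝓘(ℝ, EM) EM x
    obtain ⟨ρ, -, hρ⟩ := (SmoothBumpFunction.nhds_basis_tsupport (I := 𝓘(ℝ, EM)) m).mem_iff.1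
      (interior_mem_nhds.2 hs)
    refine ⟨(ρ : M → ℝ) • FiberBundle.extend EM x, ?_, ?_⟩
    · exact ContMDiffOn.smul_section_of_tsupport (ρ.contMDiff.contMDiffOn) isOpen_interior hρ
        (hsx.mono interior_subset)
    · simp
  rw [extendVector, dif_pos h]
  exact h.choose_spec

variable {EB : Type*} [NormedAddCommGroup EB] [NormedSpace ℝ EB] [FiniteDimensional ℝ EB]
  {B : Type*} [TopologicalSpace B] [ChartedSpace EB B] [IsManifold 𝓘(ℝ, EB) ∞ B]
  {EF : Type*} [NormedAddCommGroup EF] [NormedSpace ℝ EF]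
  {F : Type*} [TopologicalSpace F] [ChartedSpace EF F] [IsManifold 𝓘(ℝ, EF) ∞ F]
  [FiniteDimensional ℝ EM] {π : M → B}
  {ξ : ∀ m : M, Submodule ℝ (TangentSpace 𝓘(ℝ, EM) m)}
  {α : ∀ m : M, TangentSpace 𝓘(ℝ, EM) m →L[ℝ] ℝ}

/-- Horizontal lifts of smooth vector fields are differentiable. In a chart the lift solves a
linear system that depends differentiably on the point, and it is its only solution. -/
lemma IsContactFiberBundle.differentiableAt_fieldInChart_horizontalLift
    (hξ : IsContactFiberBundle (EB := EB) (EF := EF) F π ξ) (hα : IsDefiningForm ξ α)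
    {v : ∀ b : B, TangentSpace 𝓘(ℝ, EB) b} (hv : IsSmoothVectorField v) (m : M) :
    DifferentiableAt ℝ (fieldInChart (horizontalLift π (contactConnection EB π ξ) v) m)
      (extChartAt 𝓘(ℝ, EM) m m) := by
  have : IsManifold 𝓘(ℝ, EM) 1 M := isManifold_one_of_infty
  have : IsManifold 𝓘(ℝ, EB) 1 B := isManifold_one_of_infty
  have hπ : ContMDiffAt 𝓘(ℝ, EM) 𝓘(ℝ, EB) 2 π m := (hξ.smooth_proj m).of_le (by norm_cast)
  set φ := extChartAt 𝓘(ℝ, EM) m with hφ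
  set ψ := extChartAt 𝓘(ℝ, EB) (π m) with hψ
  have hφm : φ.symm (φ m) = m := extChartAt_to_inv m
  have hφs : MDifferentiableAt 𝓘(ℝ, EM) 𝓘(ℝ, EM) φ.symm (φ m) :=
    (contMDiffAt_extChartAt_symm (n := ∞) le_rfl (mem_extChartAt_target m)).mdifferentiableAt
      (by simp)
  set a := oneFormInChart α m with ha
  set p : EM → EB := writtenInExtChartAt 𝓘(ℝ, EM) 𝓘(ℝ, EB) m π with hp
  have ha2 : ContDiffAt ℝ 2 a (φ m) := hα.smooth.contDiffAt_oneFormInChart m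
  have hp2 : ContDiffAt ℝ 2 p (φ m) := contDiffAt_writtenInExtChartAt hπ
  -- Tangent spaces are identified with the model spaces, to compare objects at equal points.
  let S : EM → (EM →L[ℝ] EM) := fun z => mfderiv 𝓘(ℝ, EM) 𝓘(ℝ, EM) φ.symm z
  let Q : B → (EB →L[ℝ] EB) := fun b => mfderiv 𝓘(ℝ, EB) 𝓘(ℝ, EB) ψ b
  let dπ : M → (EM →L[ℝ] EB) := fun m' => mfderiv 𝓘(ℝ, EM) 𝓘(ℝ, EB) π m'
  let dα : M → (EM →L[ℝ] EM →L[ℝ] ℝ) := fun m' => extDerivOneForm α m'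
  let v' : B → EB := v
  let L : M → EM := horizontalLift π (contactConnection EB π ξ) v
  have hL : ∀ m', IsHorizontal (E := EM) (G := EB) (α m' : EM →L[ℝ] ℝ) (dπ m') (dα m') (L m') ∧
      dπ m' (L m') = v' (π m') := fun m' => hξ.horizontalLift_spec hα v m'
  -- The vector field `v` in the chart of `B`, along the projection.
  have hg : DifferentiableAt ℝ (fun z => Q (π (φ.symm z)) (v' (π (φ.symm z)))) (φ m) := by
    rw [← mdifferentiableAt_iff_differentiableAt]
    have h1 : MDifferentiableAt 𝓘(ℝ, EM) 𝓘(ℝ, EB) (π ∘ φ.symm) (φ m) :=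
      MDifferentiableAt.comp_of_eq (x := φ m) (hπ.mdifferentiableAt (by norm_num)) hφs hφm
    have h2 : (π ∘ φ.symm) (φ m) = π m := congrArg π hφm
    exact MDifferentiableAt.comp_of_eq (x := φ m)
      (hv.mdifferentiableAt_mfderiv_extChartAt (π m)) h1 h2
  -- The differential of the projection in the charts.
  have hev : ∀ᶠ z in 𝓝 (φ m), z ∈ φ.target ∧ π (φ.symm z) ∈ ψ.source := by
    refine Filter.Eventually.and
      ((isOpen_extChartAt_target m).mem_nhds (mem_extChartAt_target m)) ?_
    have h1 : ContinuousAt (π ∘ φ.symm) (φ m) :=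
      ContinuousAt.comp_of_eq hπ.continuousAt hφs.continuousAt hφm
    have h2 : (π ∘ φ.symm) (φ m) = π m := congrArg π hφm
    refine h1.eventually ?_
    rw [h2]
    exact extChartAt_source_mem_nhds (π m)
  have hpd : ∀ z, z ∈ φ.target → π (φ.symm z) ∈ ψ.source → ∀ u,
      fderiv ℝ p z u = Q (π (φ.symm z)) (dπ (φ.symm z) (S z u)) := by
    intro z hz hz' u
    have hφz : MDifferentiableAt 𝓘(ℝ, EM) 𝓘(ℝ, EM) φ.symm z :=
      (contMDiffAt_extChartAt_symm (n := ∞) le_rfl hz).mdifferentiableAt (by simp)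
    have hπz : MDifferentiableAt 𝓘(ℝ, EM) 𝓘(ℝ, EB) π (φ.symm z) :=
      (hξ.smooth_proj _).mdifferentiableAt (by simp)
    have hψz : MDifferentiableAt 𝓘(ℝ, EB) 𝓘(ℝ, EB) ψ (π (φ.symm z)) :=
      mdifferentiableAt_extChartAt (by simpa [hψ] using hz')
    rw [← mfderiv_eq_fderiv]
    have e1 := mfderiv_comp z hψz (hπz.comp z hφz)
    have e2 := mfderiv_comp z hπz hφz
    rw [e2] at e1
    exact congr($e1 u)
  have hQinj : ∀ b ∈ ψ.source, Function.Injective (Q b) := fun b hb =>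
    (isInvertible_mfderiv_extChartAt hb).injective
  have hcontact : IsFiberwiseContact (a (φ m)) (fderiv ℝ p (φ m)) (modelExtDeriv a (φ m)) := by
    have h1 : a (φ m) = α m := ContinuousLinearMap.ext (oneFormInChart_self α)
    have h2 : fderiv ℝ p (φ m) = dπ m :=
      (mfderiv_eq_fderiv_writtenInExtChartAt (hπ.mdifferentiableAt (by norm_num))).symm
    have h3 : modelExtDeriv a (φ m) = dα m := by
      ext x y
      exact (extDerivOneForm_eq_modelExtDeriv α m x y).symm
    rw [h1, h2, h3]
    exact hξ.isFiberwiseContact hα m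
  obtain ⟨X, hX, hXev⟩ := exists_differentiableAt_lift (ha2.differentiableAt (by norm_num))
    ((hp2.fderiv_right (m := 1) (by norm_num)).differentiableAt (by norm_num))
    (differentiableAt_modelExtDeriv ha2) hg hcontact
  refine hX.congr_of_eventuallyEq ?_
  filter_upwards [hXev, hev] with z hXz hz
  obtain ⟨⟨h1, h2⟩, h3⟩ := hXz
  -- Pushed forward to `M`, the solution `X` satisfies the equations that determine the lift.
  have hLX : L (φ.symm z) = S z (X z) := by
    refine (hξ.isFiberwiseContact hα (φ.symm z)).eq_of_isHorizontal (hL _).1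
      ⟨h1, fun y hy hPy => ?_⟩ ((hL _).2.trans (hQinj _ hz.2 ?_))
    · let u : EM := mfderiv 𝓘(ℝ, EM) 𝓘(ℝ, EM) φ (φ.symm z) y
      have hu : S z u = y := mfderiv_symm_comp_extChartAt hz.1 y
      have h4 : dα (φ.symm z) (S z (X z)) (S z u) = modelExtDeriv a z (X z) u :=
        extDerivOneForm_extChartAt_symm hα.smooth hz.1 (X z) u
      rw [hu] at h4
      refine h4.trans (h2 u ?_ ?_)
      · exact (congrArg (α (φ.symm z) : EM →L[ℝ] ℝ) hu).trans hy
      · rw [hpd z hz.1 hz.2, hu]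
        exact (congrArg (Q _) hPy).trans (map_zero _)
    · exact (h3.symm.trans (hpd z hz.1 hz.2 (X z)))
  exact (congrArg (fun t : EM => (mfderiv 𝓘(ℝ, EM) 𝓘(ℝ, EM) φ (φ.symm z) : EM →L[ℝ] EM) t)
    hLX).trans (mfderiv_extChartAt_comp_symm hz.1 (X z))

/-- The curvature is measured by `dα` on horizontal lifts: as `α` annihilates them, Cartan's
formula gives `α (Curv (x, y)) = α [v^#, w^#] = - dα (v^#, w^#)`. -/
lemma IsContactFiberBundle.apply_curvature [T2Space B]
    (hξ : IsContactFiberBundle (EB := EB) (EF := EF) F π ξ) (hα : IsDefiningForm ξ α) (m : M)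
    (x y : TangentSpace 𝓘(ℝ, EB) (π m)) :
    α m (curvature π (contactConnection EB π ξ) m x y) =
      -extDerivOneForm α m
        (horizontalLift π (contactConnection EB π ξ) (extendVector x) m)
        (horizontalLift π (contactConnection EB π ξ) (extendVector y) m) := by
  rw [extDerivOneForm_eq_neg_mlieBracket hα.smooth
    (hξ.differentiableAt_fieldInChart_horizontalLift hα (extendVector_spec x).1 m)
    (hξ.differentiableAt_fieldInChart_horizontalLift hα (extendVector_spec y).1 m)
    (fun m' => (hξ.horizontalLift_spec hα _ m').1.1)
    (fun m' => (hξ.horizontalLift_spec hα _ m').1.1), neg_neg, curvature, curvatureOfFields,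
    map_sub]
  exact sub_eq_self.2 (hξ.horizontalLift_spec hα _ m).1.1

/-- A covector that annihilates `ker a` is a multiple of `a`. -/
lemma exists_eq_smul_of_ker_le {E : Type*} [NormedAddCommGroup E] [NormedSpace ℝ E]
    {a η : E →L[ℝ] ℝ} (h : ∀ u, a u = 0 → η u = 0) : ∃ c : ℝ, η = c • a := by
  by_cases ha : a = 0
  · exact ⟨0, by ext u; simp [h u (by simp [ha])]⟩
  obtain ⟨u, hu⟩ : ∃ u, a u ≠ 0 := by
    by_contra! h
    exact ha (ContinuousLinearMap.ext h)
  refine ⟨η u / a u, ContinuousLinearMap.ext fun w => ?_⟩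
  have h1 := h (a u • w - a w • u) (by simp [mul_comm])
  simp only [map_sub, map_smul, smul_eq_mul] at h1
  simp only [smul_apply, smul_eq_mul]
  field_simp
  linarith

/-- Nondegeneracy of `dα` on `ξ` at one point is nondegeneracy of the curvature at that point. -/
lemma IsContactFiberBundle.nondegenerate_iff_curvature [T2Space B]
    (hξ : IsContactFiberBundle (EB := EB) (EF := EF) F π ξ) (hα : IsDefiningForm ξ α) (m : M) :
    (∀ x ∈ ξ m, (∀ y ∈ ξ m, extDerivOneForm α m x y = 0) → x = 0) ↔
      ∀ η : TangentSpace 𝓘(ℝ, EM) m →L[ℝ] ℝ, (∀ u ∈ ξ m, η u = 0) → η ≠ 0 →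
        ∀ x : TangentSpace 𝓘(ℝ, EB) (π m),
          (∀ y : TangentSpace 𝓘(ℝ, EB) (π m),
            η (curvature π (contactConnection EB π ξ) m x y) = 0) → x = 0 := by
  have hiff := (hξ.isFiberwiseContact hα m).nondegenerate_iff
    (l := fun x => horizontalLift π (contactConnection EB π ξ) (extendVector (b := π m) x) m)
    (fun x => (hξ.horizontalLift_spec hα _ m).1)
    (fun x => (hξ.horizontalLift_spec hα _ m).2.trans (extendVector_spec x).2)
  have hcurv := hξ.apply_curvature hα m
  have hξα : (∀ x ∈ ξ m, (∀ y ∈ ξ m, extDerivOneForm α m x y = 0) → x = 0) ↔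
      ∀ x, α m x = 0 → (∀ y, α m y = 0 → extDerivOneForm α m x y = 0) → x = 0 := by
    simp only [hα.mem_iff]
  refine hξα.trans (hiff.trans ⟨fun h η hη hη0 x hx => h x fun y => ?_, fun h x hx => ?_⟩)
  · obtain ⟨c, hc⟩ := exists_eq_smul_of_ker_le (E := EM) (a := α m) (η := η)
      fun u hu => hη u ((hα.mem_iff m u).2 hu)
    have hc0 : c ≠ 0 := by
      rintro rfl
      exact hη0 (hc.trans (zero_smul _ _))
    have h1 : c * α m (curvature π (contactConnection EB π ξ) m x y) = 0 :=
      (congr($hc (curvature π (contactConnection EB π ξ) m x y))).symm.trans (hx y)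
    have h2 := (mul_eq_zero.1 h1).resolve_left hc0
    exact neg_eq_zero.1 ((hcurv x y).symm.trans h2)
  · refine h (α m) (fun u hu => (hα.mem_iff m u).1 hu) (hα.ne_zero m) x fun y => ?_
    exact (hcurv x y).trans (neg_eq_zero.2 (hx y))

end Curvature

end ContactGeometry

theorem proposition3p1
    {EB : Type*} [NormedAddCommGroup EB] [NormedSpace ℝ EB] [FiniteDimensional ℝ EB]
    {B : Type*} [TopologicalSpace B] [T2Space B] [ChartedSpace EB B] [IsManifold 𝓘(ℝ, EB) ∞ B]
    {EF : Type*} [NormedAddCommGroup EF] [NormedSpace ℝ EF] [FiniteDimensional ℝ EF]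
    {F : Type*} [TopologicalSpace F] [T2Space F] [ChartedSpace EF F] [IsManifold 𝓘(ℝ, EF) ∞ F]
    {EM : Type*} [NormedAddCommGroup EM] [NormedSpace ℝ EM] [FiniteDimensional ℝ EM]
    {M : Type*} [TopologicalSpace M] [T2Space M] [ChartedSpace EM M] [IsManifold 𝓘(ℝ, EM) ∞ M]
    (π : M → B) (ξ : ∀ m : M, Submodule ℝ (TangentSpace 𝓘(ℝ, EM) m))
    (hξ : ContactGeometry.IsContactFiberBundle (EB := EB) (EF := EF) F π ξ) :
    ContactGeometry.IsContactStructure ξ ↔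
      ∀ (m : M) (η : TangentSpace 𝓘(ℝ, EM) m →L[ℝ] ℝ), (∀ u ∈ ξ m, η u = 0) → η ≠ 0 →
        ∀ x : TangentSpace 𝓘(ℝ, EB) (π m),
          (∀ y : TangentSpace 𝓘(ℝ, EB) (π m),
            η (ContactGeometry.curvature π (ContactGeometry.contactConnection EB π ξ) m x y) = 0) →
          x = 0 := by
  constructor
  · rintro ⟨α, hα, hnd⟩ m
    exact (hξ.nondegenerate_iff_curvature hα m).1 (hnd m)
  · intro h
    obtain ⟨α, hα⟩ := hξ.cooriented
    exact ⟨α, hα, fun m => (hξ.nondegenerate_iff_curvature hα m).2 (h m)⟩
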